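/- **Setting.** Let $\mathcal A=(V,E,\mathrm{src},\mathrm{tgt})$ be an arena: $V$ is a finite set of states, $\mathrm{src},\mathrm{tgt}\in V$, and $E$ is a partial function that assigns to pairs $(u,v)\in V\times V$ (the edges) a cost function $f_{uv}\colon\mathbb N\to\mathbb N$ that is non-decreasing and piecewise affine with finitely many pieces. The only edge leaving $\mathrm{tgt}$ is a self-loop with cost function $0$, and $\mathrm{tgt}$ is reachable from every state. Let $n\in\mathbb N$ be the number of players, $[n]=\{1,\dots,n\}$, and $\kappa=\max_{e\in E} f_e(n)$; $|E|$ is the number of edges. A *configuration* is a map $c\colon[n]\to V$; $c_{\mathrm{src}}$ and $c_{\mathrm{tgt}}$ are the constant maps $\mathrm{src}$ and $\mathrm{tgt}$. There is a *transition* $c\Rightarrow c'$ if $(c(i),c'(i))$ is an edge for all $i$; its cost for player $i$ is $\mathrm{cost}_i(c,c')=f_{c(i)c'(i)}(\#\{l\in[n] : (c(l),c'(l))=(c(i),c'(i))\})$. For an infinite path $\rho=\rho_0\Rightarrow\rho_1\Rightarrow\cdots$, $\mathrm{cost}_i(\rho)=+\infty$ if $\rho_k(i)\ne\mathrm{tgt}$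 for all $k$, and $\mathrm{cost}_i(\rho)=\sum_{k}\mathrm{cost}_i(\rho_k,\rho_{k+1})$ otherwise; $\rho_{\ge k}$ is the suffix starting at $\rho_k$. A strategy of player $i$ from $c$ maps each finite path from $c$ to an edge leaving the state of player $i$ in the last configuration of the path; a profile of strategies from $c$ determines an infinite path from $c$, its outcome. A profile is a Nash equilibrium if the strategy of each player is a best response to the strategies of the others (it minimizes the player's cost of the outcome). A *subgame-perfect equilibrium* (SPE) is a profile from $c_{\mathrm{src}}$ whose residual profile after each finite path from $c_{\mathrm{src}}$ is a Nash equilibrium. **Labelling functions.** Let $X_{j}$ be the set of configurations with exactly $j$ players at $\mathrm{tgt}$, and $X_{\ge j}=\bigcup_{l\ge j}X_l$. Let $\lambda=(\lambda_i)_{i\in[n]}$, where $\lambda_i$ maps the transitions from configurations of $X_{\ge j}$ into $\mathbb N\cup\{-\infty,+\infty\}$. For $c\in X_{\ge j}$, an infinite path $\rho$ from $c$ is *$\lambda$-consistent* if it visits $c_{\mathrm{tgt}}$ and $\mathrm{cost}_i(\rho_{\ge k})\le\lambda_i(\rho_k,\rho_{k+1})$ for all $i$ and $k$; $\Lambda_\lambda(c)$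 is the set of these paths. Let $\mathrm{dev}_i(c,c')=\{c'' : c\Rightarrow c''\text{ and } c''(l)=c'(l)\text{ for all } l\neq i\}$. The labellings $\lambda^{j*}$, $0\le j\le n$, of the transitions from $X_{\ge j}$ are defined by downward induction on $j$. First, $\lambda^{n*}_i=0$. For $j<n$, $\lambda^{j*}$ is the pointwise limit of the sequence $(\mu^k)_{k\ge0}$ defined as follows. For a transition $c\Rightarrow c'$ with $c\in X_{\ge j+1}$, $\mu^k_i(c,c')=\lambda^{(j+1)*}_i(c,c')$ for all $k$. For $c\in X_j$ with $c(i)=\mathrm{tgt}$, $\mu^k_i(c,c')=0$ for all $k$. For $c\in X_j$ with $c(i)\neq\mathrm{tgt}$, $\mu_i^0(c,c')=+\infty$, and for $k\ge1$ $$\mu^k_i(c,c')=\min_{c''\in\mathrm{dev}_i(c,c')}\ \sup_{\rho\in\Lambda_{\mu^{k-1}}(c'')}\bigl(\mathrm{cost}_i(c,c'')+\mathrm{cost}_i(\rho)\bigr)$$ if $\Lambda_{\mu^{k-1}}(\tilde c)\neq\emptyset$ for all $\tilde c$ with $c\Rightarrow\tilde c$, and $\mu^k_i(c,c')=-\infty$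 otherwise. **Theorem.** 1. An infinite path $\rho$ from $c_{\mathrm{src}}$ is the outcome of an SPE if and only if it is $\lambda^{0*}$-consistent, that is, $\rho\in\Lambda_{\lambda^{0*}}(c_{\mathrm{src}})$. 2. For all $0\le j\le n$, all $i\in[n]$ and all transitions $c\Rightarrow c'$ with $c\in X_{\ge j}$, $\lambda^{j*}_i(c,c')\le|V|\cdot\kappa$. 3. For each $j<n$, the sequence $(\mu^k)_{k\ge0}$ that defines $\lambda^{j*}$ stabilizes after at most $|V|\,(1+n\cdot\kappa\cdot|E|^n)$ steps: for all $k$ at least this number, $\mu^k=\lambda^{j*}$ on the transitions from $X_{\ge j}$. -/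

import Mathlib

namespace DynNCG

/-- The family of cost functions: non-decreasing functions from `ℕ` to `ℕ` that are piecewise
affine with finitely many pieces (the pieces being intervals that cover `ℕ`). -/
def IsCostFunction (f : ℕ → ℕ) : Prop :=
  Monotone f ∧
    ∃ P : Set (Set ℕ), P.Finite ∧ ⋃₀ P = Set.univ ∧
      ∀ I ∈ P, I.OrdConnected ∧ ∃ a b : ℤ, ∀ x ∈ I, (f x : ℤ) = a * (x : ℤ) + b

/-- An arena on the set of states `V`. The partial function `E : V × V → F` is `edge`, with value
`none` where it is undefined. -/
structure Arena (V : Type*) where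
  src : V
  tgt : V
  edge : V → V → Option (ℕ → ℕ)
  edge_cost : ∀ u v f, edge u v = some f → IsCostFunction f
  tgt_loop : edge tgt tgt = some (fun _ => 0)
  tgt_sink : ∀ v, v ≠ tgt → edge tgt v = none
  tgt_reachable : ∀ v, Relation.ReflTransGen (fun u w => (edge u w).isSome) v tgt

variable {V : Type*}

/-- There is an edge from `u` to `v` (it is unique). -/
def Arena.IsEdge (A : Arena V) (u v : V) : Prop := (A.edge u v).isSome

/-- The cost of using the edge from `u` to `v` when `l` players use it simultaneously (`0` if there
is no such edge). -/
def Arena.edgeCost (A : Arena V) (u v : V) (l : ℕ) : ℕ :=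
  match A.edge u v with
  | some f => f l
  | none => 0

/-- The number of edges of the arena. -/
def Arena.numEdges [Fintype V] (A : Arena V) : ℕ :=
  (Finset.univ.filter fun p : V × V => (A.edge p.1 p.2).isSome).card

/-- `κ`, the maximum over all edges of their cost for `n` players. -/
def Arena.maxCost [Fintype V] (A : Arena V) (n : ℕ) : ℕ :=
  Finset.univ.sup fun p : V × V => A.edgeCost p.1 p.2 n

/-- Configurations: the position of each of the `n` players. -/
abbrev Config (V : Type*) (n : ℕ) := Fin n → V

variable {n : ℕ}

/-- The initial configuration, all players being at the source. -/
def srcConfig (A : Arena V) (n : ℕ) : Config V n := fun _ => A.src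

/-- The target configuration, all players being at the target. -/
def tgtConfig (A : Arena V) (n : ℕ) : Config V n := fun _ => A.tgt

/-- The transition relation of the configuration graph. As there is at most one edge between two
states, the edges used by the players and the costs are determined by the two configurations. -/
def Step (A : Arena V) (c c' : Config V n) : Prop := ∀ i, A.IsEdge (c i) (c' i)

variable [DecidableEq V]

/-- The number of players that use the same edge as player `i` in the transition from `c` to
`c'`. -/
def load (c c' : Config V n) (i : Fin n) : ℕ :=
  (Finset.univ.filter fun j => c j = c i ∧ c' j = c' i).card

/-- The cost for player `i` of the transition from `c` to `c'`. -/
def stepCost (A : Arena V) (i : Fin n) (c c' : Config V n) : ℕ :=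
  A.edgeCost (c i) (c' i) (load c c' i)

/-- `ρ` is an infinite path from `c` in the configuration graph. -/
def IsPathFrom (A : Arena V) (c : Config V n) (ρ : ℕ → Config V n) : Prop :=
  ρ 0 = c ∧ ∀ k, Step A (ρ k) (ρ (k + 1))

/-- The suffix of a path that starts at position `k`. -/
def suffix (ρ : ℕ → Config V n) (k : ℕ) : ℕ → Config V n := fun l => ρ (k + l)

open Classical in
/-- The cost of an infinite path for player `i`: infinite if the player never visits the target,
and the sum of the costs of the transitions otherwise. -/
noncomputable def pathCost (A : Arena V) (i : Fin n) (ρ : ℕ → Config V n) : ℕ∞ :=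
  if ∀ k, ρ k i ≠ A.tgt then ⊤
  else ⨆ N : ℕ, ∑ k ∈ Finset.range N, (stepCost A i (ρ k) (ρ (k + 1)) : ℕ∞)

/-! ### Strategies and subgame-perfect equilibria -/

/-- Finite paths in the configuration graph from one configuration to another. -/
inductive FinPath (A : Arena V) (c : Config V n) : Config V n → Type _ where
  | nil : FinPath A c c
  | snoc {d d' : Config V n} (h : FinPath A c d) (s : Step A d d') : FinPath A c d'

/-- Concatenation of finite paths. -/
def FinPath.append {A : Arena V} {c d : Config V n} (h : FinPath A c d) :
    {e : Config V n} → FinPath A d e → FinPath A c e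
  | _, .nil => h
  | _, .snoc h' s => .snoc (h.append h') s

/-- A strategy of player `i` from `c` maps any finite path from `c` to a move of player `i` from the
last configuration `d` of that path, that is, to an edge out of `d i`, given by its end point. -/
def Strategy (A : Arena V) (c : Config V n) (i : Fin n) :=
  (d : Config V n) → FinPath A c d → {v : V // A.IsEdge (d i) v}

/-- Strategy profiles from `c`. -/
abbrev Profile (A : Arena V) (c : Config V n) := (i : Fin n) → Strategy A c i

/-- The residual strategy profile after the history `h`. -/
def residual {A : Arena V} {c d : Config V n} (σ : Profile A c) (h : FinPath A c d) :
    Profile A d :=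
  fun i e h' => σ i e (h.append h')

/-- The finite path followed in the first `k` rounds under a strategy profile, together with its
last configuration. -/
def run {A : Arena V} {c : Config V n} (σ : Profile A c) : ℕ → Σ d : Config V n, FinPath A c d
  | 0 => ⟨c, .nil⟩
  | k + 1 =>
    ⟨fun i => (σ i (run σ k).1 (run σ k).2).1,
      .snoc (run σ k).2 fun i => (σ i (run σ k).1 (run σ k).2).2⟩

/-- The outcome of a strategy profile. -/
def outcome {A : Arena V} {c : Config V n} (σ : Profile A c) : ℕ → Config V n :=
  fun k => (run σ k).1

/-- A Nash equilibrium from `c`: the strategy of each player is a best response to those of the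
other players. -/
def IsNash {A : Arena V} {c : Config V n} (σ : Profile A c) : Prop :=
  ∀ i, pathCost A i (outcome σ) =
    ⨅ τ : Strategy A c i, pathCost A i (outcome (Function.update σ i τ))

/-- A subgame-perfect equilibrium from `c`: the residual strategy profile after any finite path
from `c` is a Nash equilibrium. -/
def IsSPE {A : Arena V} {c : Config V n} (σ : Profile A c) : Prop :=
  ∀ (d : Config V n) (h : FinPath A c d), IsNash (residual σ h)

/-! ### Labelling functions -/

/-- Families, indexed by the players, of labellings of transitions with values in
`ℕ ∪ {-∞, +∞}`. They are defined on all pairs of configurations, but only their values on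
transitions of the region under consideration matter. -/
abbrev Labelling (V : Type*) (n : ℕ) := Fin n → Config V n → Config V n → WithBot ℕ∞

/-- The number of players at the target: `c` is in the region `X_j` if this number is `j`, and in
`X_{≥ j}` if it is at least `j`. -/
def numAtTarget (A : Arena V) (c : Config V n) : ℕ :=
  (Finset.univ.filter fun i => c i = A.tgt).card

/-- The set of `lam`-consistent paths from `c`: the infinite paths from `c` that visit the target
configuration, and whose suffixes cost each player at most the label of their first transition. -/
def consistentPaths (A : Arena V) (lam : Labelling V n) (c : Config V n) :
    Set (ℕ → Config V n) :=
  {ρ | IsPathFrom A c ρ ∧ (∃ k, ρ k = tgtConfig A n) ∧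
    ∀ i k, ((pathCost A i (suffix ρ k) : ℕ∞) : WithBot ℕ∞) ≤ lam i (ρ k) (ρ (k + 1))}

/-- The configurations that are reached from `c` when all players but `i` play as in the
transition from `c` to `c'`. -/
def dev (A : Arena V) (i : Fin n) (c c' : Config V n) : Set (Config V n) :=
  {c'' | Step A c c'' ∧ ∀ j, j ≠ i → c'' j = c' j}

open Classical in
/-- The building functions `μ^k` of the labelling of the region `X_{≥ j}`, given the labelling
`next` of the region `X_{≥ j + 1}`. -/
noncomputable def building (A : Arena V) (j : ℕ) (next : Labelling V n) : ℕ → Labelling V n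
  | 0 => fun i c c' =>
    if j + 1 ≤ numAtTarget A c then next i c c'
    else if c i = A.tgt then 0
    else ⊤
  | k + 1 => fun i c c' =>
    if j + 1 ≤ numAtTarget A c then next i c c'
    else if c i = A.tgt then 0
    else if ∀ d, Step A c d → (consistentPaths A (building A j next k) d).Nonempty then
      ((⨅ c'' ∈ dev A i c c', ⨆ ρ ∈ consistentPaths A (building A j next k) c'',
        ((stepCost A i c c'' : ℕ∞) + pathCost A i ρ) : ℕ∞) : WithBot ℕ∞)
    else ⊥

/-- The pointwise limit of a sequence of labellings: the value which the sequence eventually takes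
at each argument (arbitrary if there is none). -/
noncomputable def limitLabelling (u : ℕ → Labelling V n) : Labelling V n :=
  fun i c c' => Classical.epsilon fun v => ∀ᶠ k in Filter.atTop, u k i c c' = v

/-- The labelling `λ^{j*}` of the transitions in the region `X_{≥ j}`, for `0 ≤ j ≤ n`. -/
noncomputable def lamStar (A : Arena V) (n : ℕ) (j : ℕ) : Labelling V n :=
  if j < n then limitLabelling (building A j (lamStar A n (j + 1)))
  else fun _ _ _ => 0
termination_by n - j

end DynNCG

namespace DynNCG

/-! ### Shortest paths to the target in the arena. -/

section Distance

variable {V : Type*} (A : Arena V)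

/-! The number of players at the target never decreases along a path, so the labels on each region
can be computed from those on the next one. All levels then agree where they overlap, and `λ^{0*}`
is a fixed point of the operator `improve` for players not yet at the target
(`lamStar_zero_eq_improve`).

Every SPE outcome is consistent. Residuals of an SPE are SPEs, and no one-shot deviation pays, so
induction on the iterations shows that SPE costs respect every building function
(`IsSPE.pathCost_le_building`).

Conversely, by the fixed-point equation, a consistent path can be replaced, after any transition
that leaves it, by a consistent path making a unilateral deviation unprofitable (`exists_revision`).
Following the current plan and revising it after each departure is an SPE: the one-shot inequalities
telescope, and a deviator who never arrives pays `⊤` (`exists_isSPE_of_revise`).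

For the bounds, a player can always deviate along a shortest path, so after `|V|` iterations labels
are at most distance times `κ` (`building_le_dist_mul`). From then on the sum of their ranks drops
until one iteration changes nothing on the region, and this is permanent (`building_stabilizes`). -/

theorem Arena.eq_tgt_of_isEdge {v : V} (h : A.IsEdge A.tgt v) : v = A.tgt := by
  by_contra hv
  simp [Arena.IsEdge, A.tgt_sink v hv] at h

/-- The target can be reached from `v` in exactly `d` steps. -/
def Arena.ReachesIn : ℕ → V → Prop
  | 0, v => v = A.tgt
  | d + 1, v => ∃ u, A.IsEdge v u ∧ Arena.ReachesIn d u

theorem Arena.exists_reachesIn (v : V) : ∃ d, A.ReachesIn d v := by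
  refine Relation.ReflTransGen.head_induction_on (A.tgt_reachable v) ⟨0, rfl⟩ ?_
  rintro a b hab - ⟨d, hd⟩
  exact ⟨d + 1, b, hab, hd⟩

/-- The distance of a state to the target. -/
noncomputable def Arena.dist (v : V) : ℕ := sInf {d | A.ReachesIn d v}

theorem Arena.reachesIn_dist (v : V) : A.ReachesIn (A.dist v) v :=
  Nat.sInf_mem (A.exists_reachesIn v)

theorem Arena.dist_le {d : ℕ} {v : V} (h : A.ReachesIn d v) : A.dist v ≤ d := Nat.sInf_le h

theorem Arena.eq_tgt_of_dist_eq_zero {v : V} (h : A.dist v = 0) : v = A.tgt := by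
  have := A.reachesIn_dist v
  rwa [h] at this

theorem Arena.exists_isEdge_dist (v : V) : ∃ u, A.IsEdge v u ∧ A.dist u = A.dist v - 1 := by
  rcases hd : A.dist v with _ | d
  · obtain rfl := A.eq_tgt_of_dist_eq_zero hd
    exact ⟨A.tgt, by simp [Arena.IsEdge, A.tgt_loop], hd⟩
  · have h := A.reachesIn_dist v
    rw [hd] at h
    obtain ⟨u, hu, hdu⟩ := h
    have h1 := A.dist_le hdu
    have h2 : A.dist v ≤ A.dist u + 1 := A.dist_le ⟨u, hu, A.reachesIn_dist u⟩
    exact ⟨u, hu, by omega⟩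

/-- The successor of a state on a shortest path to the target. -/
noncomputable def Arena.toward (v : V) : V := (A.exists_isEdge_dist v).choose

theorem Arena.isEdge_toward (v : V) : A.IsEdge v (A.toward v) :=
  (A.exists_isEdge_dist v).choose_spec.1

theorem Arena.dist_toward (v : V) : A.dist (A.toward v) = A.dist v - 1 :=
  (A.exists_isEdge_dist v).choose_spec.2

theorem Arena.dist_toward_iterate (v : V) (k : ℕ) :
    A.dist (A.toward^[k] v) = A.dist v - k := by
  induction k with
  | zero => rfl
  | succ k ih => rw [Function.iterate_succ_apply', A.dist_toward, ih, Nat.sub_sub]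

/-- The states on a shortest path have pairwise different distances, hence are distinct. -/
theorem Arena.dist_lt_card [Fintype V] (v : V) : A.dist v < Fintype.card V := by
  have h : Function.Injective fun k : Fin (A.dist v + 1) => A.toward^[k] v := by
    intro k l hkl
    have := congrArg A.dist hkl
    simp only [A.dist_toward_iterate] at this
    omega
  simpa using Fintype.card_le_of_injective _ h

end Distance

/-! ### Costs of paths and the regions of the configuration graph. -/

section Costs

variable {V : Type*} {n : ℕ} {A : Arena V}

theorem IsPathFrom.eq_tgt_of_le {c : Config V n} {ρ : ℕ → Config V n} (h : IsPathFrom A c ρ)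
    {i : Fin n} {k l : ℕ} (hkl : k ≤ l) (hk : ρ k i = A.tgt) : ρ l i = A.tgt := by
  induction l, hkl using Nat.le_induction with
  | base => exact hk
  | succ l _ ih =>
    have := h.2 l i
    rw [ih] at this
    exact A.eq_tgt_of_isEdge this

theorem IsPathFrom.suffix {c : Config V n} {ρ : ℕ → Config V n} (h : IsPathFrom A c ρ) (k : ℕ) :
    IsPathFrom A (ρ k) (suffix ρ k) :=
  ⟨rfl, fun l => h.2 (k + l)⟩

theorem suffix_suffix (ρ : ℕ → Config V n) (k l : ℕ) :
    suffix (suffix ρ k) l = suffix ρ (k + l) := by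
  funext m
  simp [suffix, Nat.add_assoc]

theorem step_update {c c' : Config V n} (h : Step A c c') {i : Fin n} {v : V}
    (hv : A.IsEdge (c i) v) : Function.update c' i v ∈ dev A i c c' := by
  refine ⟨fun l => ?_, fun l hl => Function.update_of_ne hl _ _⟩
  by_cases hl : l = i
  · subst hl
    rwa [Function.update_self]
  · rw [Function.update_of_ne hl]
    exact h l

variable [DecidableEq V]

theorem Step.numAtTarget_le {c c' : Config V n} (h : Step A c c') :
    numAtTarget A c ≤ numAtTarget A c' := by
  refine Finset.card_le_card fun i hi => ?_
  simp only [Finset.mem_filter, Finset.mem_univ, true_and] at hi ⊢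
  have := h i
  rw [hi] at this
  exact A.eq_tgt_of_isEdge this

theorem IsPathFrom.numAtTarget_le {c : Config V n} {ρ : ℕ → Config V n} (h : IsPathFrom A c ρ)
    (k : ℕ) : numAtTarget A c ≤ numAtTarget A (ρ k) := by
  induction k with
  | zero => rw [h.1]
  | succ k ih => exact ih.trans (h.2 k).numAtTarget_le

theorem numAtTarget_le (c : Config V n) : numAtTarget A c ≤ n := by
  simpa [numAtTarget] using Finset.card_filter_le (Finset.univ : Finset (Fin n)) _

theorem eq_tgtConfig_of_numAtTarget {c : Config V n} (h : n ≤ numAtTarget A c) :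
    c = tgtConfig A n := by
  have h2 : (Finset.univ.filter fun i => c i = A.tgt) = Finset.univ := by
    rw [← Finset.card_eq_iff_eq_univ, Fintype.card_fin]
    exact le_antisymm (numAtTarget_le c) h
  funext i
  simpa [tgtConfig] using Finset.ext_iff.1 h2 i

theorem stepCost_eq_zero {c c' : Config V n} (h : Step A c c') {i : Fin n} (hi : c i = A.tgt) :
    stepCost A i c c' = 0 := by
  have := h i
  rw [hi] at this
  simp [stepCost, Arena.edgeCost, hi, A.eq_tgt_of_isEdge this, A.tgt_loop]

theorem stepCost_le_maxCost [Fintype V] (A : Arena V) (i : Fin n) (c c' : Config V n) :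
    stepCost A i c c' ≤ A.maxCost n := by
  have hload : load c c' i ≤ n := by
    simpa [load] using Finset.card_filter_le (Finset.univ : Finset (Fin n)) _
  have h1 : stepCost A i c c' ≤ A.edgeCost (c i) (c' i) n := by
    unfold stepCost Arena.edgeCost
    split
    · next f hf => exact (A.edge_cost _ _ _ hf).1 hload
    · exact le_rfl
  exact h1.trans
    (Finset.le_sup (f := fun p : V × V => A.edgeCost p.1 p.2 n) (Finset.mem_univ (c i, c' i)))

/-- Transitions are free after arrival, so the partial sums are constant from `K` on. -/
theorem IsPathFrom.pathCost_eq_sum {c : Config V n} {ρ : ℕ → Config V n} (h : IsPathFrom A c ρ)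
    {i : Fin n} {K : ℕ} (hK : ρ K i = A.tgt) :
    pathCost A i ρ = ∑ k ∈ Finset.range K, (stepCost A i (ρ k) (ρ (k + 1)) : ℕ∞) := by
  have hv : ¬ ∀ k, ρ k i ≠ A.tgt := fun h' => h' K hK
  rw [pathCost, if_neg hv]
  refine le_antisymm (iSup_le fun N => ?_)
    (le_iSup (fun N => ∑ k ∈ Finset.range N, (stepCost A i (ρ k) (ρ (k + 1)) : ℕ∞)) K)
  refine Finset.sum_le_sum_of_ne_zero fun k _ hk => ?_
  rw [Finset.mem_range]
  by_contra hlt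
  exact hk (by simp [stepCost_eq_zero (h.2 k) (h.eq_tgt_of_le (not_lt.1 hlt) hK)])

theorem IsPathFrom.pathCost_eq_zero {c : Config V n} {ρ : ℕ → Config V n}
    (h : IsPathFrom A c ρ) {i : Fin n} (hi : c i = A.tgt) : pathCost A i ρ = 0 := by
  rw [h.pathCost_eq_sum (K := 0) (by rw [h.1, hi])]
  simp

theorem IsPathFrom.pathCost_ne_top {c : Config V n} {ρ : ℕ → Config V n}
    (h : IsPathFrom A c ρ) {i : Fin n} {K : ℕ} (hK : ρ K i = A.tgt) : pathCost A i ρ ≠ ⊤ := by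
  rw [h.pathCost_eq_sum hK]
  exact_mod_cast ENat.natCast_ne_top (∑ k ∈ Finset.range K, stepCost A i (ρ k) (ρ (k + 1)))

theorem exists_eq_tgt_of_pathCost_ne_top {ρ : ℕ → Config V n} {i : Fin n}
    (h : pathCost A i ρ ≠ ⊤) : ∃ k, ρ k i = A.tgt := by
  by_contra! h'
  exact h (if_pos h')

theorem IsPathFrom.pathCost_eq_add {c : Config V n} {ρ : ℕ → Config V n}
    (h : IsPathFrom A c ρ) (i : Fin n) :
    pathCost A i ρ = stepCost A i c (ρ 1) + pathCost A i (DynNCG.suffix ρ 1) := by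
  by_cases hv : ∃ k, ρ k i = A.tgt
  · obtain ⟨k, hk⟩ := hv
    have hk' : ρ (k + 1) i = A.tgt := h.eq_tgt_of_le (Nat.le_succ k) hk
    rw [h.pathCost_eq_sum hk', (h.suffix 1).pathCost_eq_sum (K := k)
      (by simpa [DynNCG.suffix, Nat.add_comm] using hk'), Finset.sum_range_succ', add_comm, h.1]
    simp only [DynNCG.suffix, Nat.add_comm 1]
  · push Not at hv
    have hv' : ∀ k, DynNCG.suffix ρ 1 k i ≠ A.tgt := fun k => hv (1 + k)
    rw [pathCost, if_pos hv, pathCost, if_pos hv', add_top]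

end Costs

/-! ### Consistent paths and the building functions. -/

section Labels

variable {V : Type*} [DecidableEq V] {n : ℕ} {A : Arena V}

theorem consistentPaths_mono {lam lam' : Labelling V n} (h : lam ≤ lam') (c : Config V n) :
    consistentPaths A lam c ⊆ consistentPaths A lam' c :=
  fun _ hρ => ⟨hρ.1, hρ.2.1, fun i k => (hρ.2.2 i k).trans (h i _ _)⟩

/-- A path that starts in the region `X_{≥ j}` never leaves it, so labels elsewhere are irrelevant.
-/
theorem consistentPaths_subset_of_le {j : ℕ} {lam lam' : Labelling V n}
    (h : ∀ i c c', j ≤ numAtTarget A c → Step A c c' → lam i c c' ≤ lam' i c c')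
    {c : Config V n} (hc : j ≤ numAtTarget A c) :
    consistentPaths A lam c ⊆ consistentPaths A lam' c :=
  fun _ hρ => ⟨hρ.1, hρ.2.1, fun i k =>
    (hρ.2.2 i k).trans (h i _ _ (hc.trans (hρ.1.numAtTarget_le k)) (hρ.1.2 k))⟩

theorem consistentPaths_congr {j : ℕ} {lam lam' : Labelling V n}
    (h : ∀ i c c', j ≤ numAtTarget A c → Step A c c' → lam i c c' = lam' i c c')
    {c : Config V n} (hc : j ≤ numAtTarget A c) :
    consistentPaths A lam c = consistentPaths A lam' c :=
  (consistentPaths_subset_of_le (fun i c c' h1 h2 => (h i c c' h1 h2).le) hc).antisymm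
    (consistentPaths_subset_of_le (fun i c c' h1 h2 => (h i c c' h1 h2).ge) hc)

theorem suffix_mem_consistentPaths {lam : Labelling V n} {c : Config V n} {ρ : ℕ → Config V n}
    (h : ρ ∈ consistentPaths A lam c) (k : ℕ) :
    suffix ρ k ∈ consistentPaths A lam (ρ k) := by
  refine ⟨h.1.suffix k, ?_, fun i l => ?_⟩
  · obtain ⟨m, hm⟩ := h.2.1
    exact ⟨m, funext fun i => h.1.eq_tgt_of_le (Nat.le_add_left m k) (by rw [hm]; rfl)⟩
  · rw [suffix_suffix]
    exact h.2.2 i (k + l)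

theorem pathCost_le_of_mem {lam : Labelling V n} {c : Config V n} {ρ : ℕ → Config V n}
    (h : ρ ∈ consistentPaths A lam c) (i : Fin n) :
    ((pathCost A i ρ : ℕ∞) : WithBot ℕ∞) ≤ lam i c (ρ 1) := by
  have h0 : suffix ρ 0 = ρ := funext fun k => congrArg ρ (Nat.zero_add k)
  have := h.2.2 i 0
  rwa [h0, h.1.1] at this

open Classical in
/-- The labels of the transitions from a configuration that are obtained from the costs of the
`lam`-consistent paths from the successors of that configuration. -/
noncomputable def improve (A : Arena V) (lam : Labelling V n) : Labelling V n := fun i c c' =>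
  if ∀ d, Step A c d → (consistentPaths A lam d).Nonempty then
    ((⨅ c'' ∈ dev A i c c', ⨆ ρ ∈ consistentPaths A lam c'',
      ((stepCost A i c c'' : ℕ∞) + pathCost A i ρ) : ℕ∞) : WithBot ℕ∞)
  else ⊥

/-- Larger labels allow more consistent paths: the suprema grow, and nonemptiness is preserved, so
`⊥` cannot newly appear on the larger side. -/
theorem improve_mono {lam lam' : Labelling V n} (h : lam ≤ lam') :
    improve A lam ≤ improve A lam' := by
  intro i c c'
  unfold improve
  split_ifs with h1 h2
  · exact WithBot.coe_le_coe.2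
      (iInf₂_mono fun c'' _ => biSup_mono fun ρ hρ => consistentPaths_mono h c'' hρ)
  · exact absurd (fun d hd => (h1 d hd).mono (consistentPaths_mono h d)) h2
  · exact bot_le
  · exact le_rfl

theorem improve_congr {j : ℕ} {lam lam' : Labelling V n}
    (h : ∀ i c c', j ≤ numAtTarget A c → Step A c c' → lam i c c' = lam' i c c')
    (i : Fin n) {c : Config V n} (c' : Config V n) (hc : j ≤ numAtTarget A c) :
    improve A lam i c c' = improve A lam' i c c' := by
  have h1 : ∀ d, Step A c d → consistentPaths A lam d = consistentPaths A lam' d :=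
    fun d hd => consistentPaths_congr h (hc.trans hd.numAtTarget_le)
  have h2 : (∀ d, Step A c d → (consistentPaths A lam d).Nonempty) ↔
      ∀ d, Step A c d → (consistentPaths A lam' d).Nonempty :=
    forall₂_congr fun d hd => by rw [h1 d hd]
  have h3 : (⨅ c'' ∈ dev A i c c', ⨆ ρ ∈ consistentPaths A lam c'',
      ((stepCost A i c c'' : ℕ∞) + pathCost A i ρ)) =
      ⨅ c'' ∈ dev A i c c', ⨆ ρ ∈ consistentPaths A lam' c'',
      ((stepCost A i c c'' : ℕ∞) + pathCost A i ρ) :=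
    biInf_congr fun c'' hc'' => by rw [h1 c'' hc''.1]
  classical
  unfold improve
  exact if_congr h2 (by rw [h3]) rfl

variable {j k : ℕ} {next : Labelling V n} {i : Fin n} {c c' : Config V n}

theorem building_of_le (h : j + 1 ≤ numAtTarget A c) :
    building A j next k i c c' = next i c c' := by
  cases k <;> simp only [building, if_pos h]

theorem building_of_eq_tgt (h : ¬ j + 1 ≤ numAtTarget A c) (hi : c i = A.tgt) :
    building A j next k i c c' = 0 := by
  cases k <;> simp only [building, if_neg h, if_pos hi]

theorem building_zero_of_ne_tgt (h : ¬ j + 1 ≤ numAtTarget A c) (hi : c i ≠ A.tgt) :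
    building A j next 0 i c c' = ⊤ := by
  simp only [building, if_neg h, if_neg hi]

theorem building_succ_of_ne_tgt (h : ¬ j + 1 ≤ numAtTarget A c) (hi : c i ≠ A.tgt) :
    building A j next (k + 1) i c c' = improve A (building A j next k) i c c' := by
  simp only [building, if_neg h, if_neg hi, improve]

theorem building_antitone (A : Arena V) (j : ℕ) (next : Labelling V n) :
    Antitone (building A j next) := by
  refine antitone_nat_of_succ_le fun k => ?_
  induction k with
  | zero =>
    intro i c c'
    by_cases h : j + 1 ≤ numAtTarget A c
    · rw [building_of_le h, building_of_le h]
    by_cases hi : c i = A.tgt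
    · rw [building_of_eq_tgt h hi, building_of_eq_tgt h hi]
    · rw [building_zero_of_ne_tgt h hi]
      exact le_top
  | succ k ih =>
    intro i c c'
    by_cases h : j + 1 ≤ numAtTarget A c
    · rw [building_of_le h, building_of_le h]
    by_cases hi : c i = A.tgt
    · rw [building_of_eq_tgt h hi, building_of_eq_tgt h hi]
    · rw [building_succ_of_ne_tgt h hi, building_succ_of_ne_tgt h hi]
      exact improve_mono ih i c c'

/-- Two labellings agree on the transitions from the region `X_{≥ j}`. -/
def EqOnRegion (A : Arena V) (j : ℕ) (lam lam' : Labelling V n) : Prop :=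
  ∀ i c c', j ≤ numAtTarget A c → Step A c c' → lam i c c' = lam' i c c'

theorem EqOnRegion.building_succ {k l : ℕ}
    (h : EqOnRegion A j (building A j next k) (building A j next l)) :
    EqOnRegion A j (building A j next (k + 1)) (building A j next (l + 1)) := by
  intro i c c' hc _
  by_cases h' : j + 1 ≤ numAtTarget A c
  · rw [building_of_le h', building_of_le h']
  by_cases hi : c i = A.tgt
  · rw [building_of_eq_tgt h' hi, building_of_eq_tgt h' hi]
  · rw [building_succ_of_ne_tgt h' hi, building_succ_of_ne_tgt h' hi]
    exact improve_congr h i c' hc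

/-- On the region, each building function is determined by the previous one, so a single repetition
is permanent. -/
theorem EqOnRegion.building_of_succ
    (h : EqOnRegion A j (building A j next (k + 1)) (building A j next k)) {l : ℕ} (hl : k ≤ l) :
    EqOnRegion A j (building A j next l) (building A j next k) := by
  have h1 : ∀ m, EqOnRegion A j (building A j next (k + m + 1)) (building A j next (k + m)) := by
    intro m
    induction m with
    | zero => exact h
    | succ m ih => exact ih.building_succ
  induction l, hl using Nat.le_induction with
  | base => exact fun _ _ _ _ _ => rfl
  | succ l hl ih =>
    obtain ⟨m, rfl⟩ := Nat.exists_eq_add_of_le hl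
    exact fun i c c' hc hs => (h1 m i c c' hc hs).trans (ih i c c' hc hs)

variable [Fintype V]

/-- Deviating to the next state of a shortest path costs at most `κ`, and consistency bounds the
continuation by a label of the previous iteration at distance one less. Hence one iteration is
needed per unit of distance. -/
theorem building_le_dist_mul
    (hnext : ∀ i c c', j + 1 ≤ numAtTarget A c → Step A c c' →
      next i c c' ≤ ((A.dist (c i) * A.maxCost n : ℕ) : ℕ∞))
    (hc : j ≤ numAtTarget A c) (hs : Step A c c') (hk : A.dist (c i) ≤ k) :
    building A j next k i c c' ≤ ((A.dist (c i) * A.maxCost n : ℕ) : ℕ∞) := by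
  induction k generalizing c c' with
  | zero =>
    by_cases h : j + 1 ≤ numAtTarget A c
    · rw [building_of_le h]
      exact hnext i c c' h hs
    · rw [building_of_eq_tgt h (A.eq_tgt_of_dist_eq_zero (Nat.le_zero.1 hk))]
      exact WithBot.coe_le_coe.2 (zero_le)
  | succ k ih =>
    by_cases h : j + 1 ≤ numAtTarget A c
    · rw [building_of_le h]
      exact hnext i c c' h hs
    by_cases hi : c i = A.tgt
    · rw [building_of_eq_tgt h hi]
      exact WithBot.coe_le_coe.2 (zero_le)
    rw [building_succ_of_ne_tgt h hi, improve]
    split_ifs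
    swap
    · exact bot_le
    have hd : A.dist (c i) ≠ 0 := fun h0 => hi (A.eq_tgt_of_dist_eq_zero h0)
    have hdev := step_update hs (A.isEdge_toward (c i))
    refine WithBot.coe_le_coe.2 ((iInf₂_le _ hdev).trans (iSup₂_le fun ρ hρ => ?_))
    set c'' := Function.update c' i (A.toward (c i)) with hc''
    have hdist : A.dist (c'' i) = A.dist (c i) - 1 := by
      rw [hc'', Function.update_self, A.dist_toward]
    have hstep : Step A c'' (ρ 1) := by
      have := hρ.1.2 0
      rwa [hρ.1.1] at this
    have h1 := (pathCost_le_of_mem hρ i).trans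
      (ih (hc.trans hdev.1.numAtTarget_le) hstep (by omega))
    have h2 : (stepCost A i c c'' : ℕ∞) ≤ (A.maxCost n : ℕ) :=
      Nat.cast_le.2 (stepCost_le_maxCost A i c c'')
    refine (add_le_add h2 (WithBot.coe_le_coe.1 h1)).trans (le_of_eq ?_)
    obtain ⟨d, hd⟩ := Nat.exists_eq_succ_of_ne_zero hd
    have h3 : A.maxCost n + A.dist (c'' i) * A.maxCost n = A.dist (c i) * A.maxCost n := by
      rw [hdist, hd, Nat.succ_sub_one, Nat.succ_mul, Nat.add_comm]
    rw [← h3, Nat.cast_add]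

theorem pathCost_eq_zero_of_maxCost (h0 : A.maxCost n = 0) {ρ : ℕ → Config V n} {K : ℕ}
    (hρ : IsPathFrom A c ρ) (hK : ρ K i = A.tgt) : pathCost A i ρ = 0 := by
  rw [hρ.pathCost_eq_sum hK]
  refine Finset.sum_eq_zero fun k _ => ?_
  have := stepCost_le_maxCost A i (ρ k) (ρ (k + 1))
  rw [h0, Nat.le_zero] at this
  rw [this, Nat.cast_zero]

/-- If `κ = 0`, sending every player along a shortest path is free, which any nonnegative labelling
allows. -/
theorem consistentPaths_nonempty_of_maxCost (h0 : A.maxCost n = 0) {lam : Labelling V n}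
    (h : ∀ i c c', j ≤ numAtTarget A c → Step A c c' → 0 ≤ lam i c c')
    (hc : j ≤ numAtTarget A c) : (consistentPaths A lam c).Nonempty := by
  set ρ : ℕ → Config V n := fun k i => A.toward^[k] (c i) with hρ
  have hpath : IsPathFrom A c ρ := by
    refine ⟨rfl, fun k i => ?_⟩
    simp only [hρ, Function.iterate_succ_apply']
    exact A.isEdge_toward _
  have htgt : ∀ i, ρ (Fintype.card V) i = A.tgt := fun i => by
    refine A.eq_tgt_of_dist_eq_zero ?_
    have := A.dist_lt_card (c i)
    rw [A.dist_toward_iterate]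
    omega
  refine ⟨ρ, hpath, ⟨_, funext htgt⟩, fun i k => ?_⟩
  rw [pathCost_eq_zero_of_maxCost h0 (hpath.suffix k) (K := Fintype.card V)
    (hpath.eq_tgt_of_le (Nat.le_add_left _ k) (htgt i))]
  exact h i _ _ (hc.trans (hpath.numAtTarget_le k)) (hpath.2 k)

theorem building_nonneg_of_maxCost (h0 : A.maxCost n = 0)
    (hnext : ∀ i c c', j + 1 ≤ numAtTarget A c → Step A c c' → 0 ≤ next i c c')
    (hc : j ≤ numAtTarget A c) (hs : Step A c c') : 0 ≤ building A j next k i c c' := by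
  induction k generalizing i c c' with
  | zero =>
    by_cases h : j + 1 ≤ numAtTarget A c
    · rw [building_of_le h]
      exact hnext i c c' h hs
    by_cases hi : c i = A.tgt
    · rw [building_of_eq_tgt h hi]
    · rw [building_zero_of_ne_tgt h hi]
      exact le_top
  | succ k ih =>
    by_cases h : j + 1 ≤ numAtTarget A c
    · rw [building_of_le h]
      exact hnext i c c' h hs
    by_cases hi : c i = A.tgt
    · rw [building_of_eq_tgt h hi]
    · rw [building_succ_of_ne_tgt h hi, improve, if_pos fun d hd =>
        consistentPaths_nonempty_of_maxCost h0 (fun i c c' => ih) (hc.trans hd.numAtTarget_le)]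
      exact WithBot.coe_le_coe.2 (zero_le)

end Labels

/-! ### Termination of the iteration and the fixed point. -/

section Stabilization

/-- The position of a label in `-∞ < 0 < 1 < ⋯`. -/
def labelRank : WithBot ℕ∞ → ℕ
  | ⊥ => 0
  | (a : ℕ∞) => a.toNat + 1

theorem labelRank_le {x : WithBot ℕ∞} {m : ℕ} (h : x ≤ ((m : ℕ∞) : WithBot ℕ∞)) :
    labelRank x ≤ m + 1 := by
  induction x with
  | bot => exact Nat.zero_le _
  | coe a => exact Nat.succ_le_succ (ENat.toNat_le_of_le_natCast (WithBot.coe_le_coe.1 h))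

/-- The finite bound matters: `ENat.toNat` sends `⊤` to `0`, so the rank is not monotone at `⊤`. -/
theorem labelRank_lt {x y : WithBot ℕ∞} {m : ℕ} (hy : y ≤ ((m : ℕ∞) : WithBot ℕ∞)) (h : x < y) :
    labelRank x < labelRank y := by
  induction y with
  | bot => exact absurd h not_lt_bot
  | coe b =>
    induction x with
    | bot => exact Nat.succ_pos _
    | coe a =>
      have hb := ne_top_of_le_ne_top (ENat.natCast_ne_top m) (WithBot.coe_le_coe.1 hy)
      have hab := WithBot.coe_lt_coe.1 h
      lift b to ℕ using hb
      lift a to ℕ using hab.ne_top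
      exact Nat.succ_lt_succ (by simpa using hab)

/-- A sequence of naturals that is non-increasing from `k₀` on fails to decrease within `f k₀` steps. -/
theorem exists_eq_succ_of_antitone {f : ℕ → ℕ} {k₀ : ℕ}
    (h : ∀ k, k₀ ≤ k → f (k + 1) ≤ f k) : ∃ k, k₀ ≤ k ∧ k ≤ k₀ + f k₀ ∧ f (k + 1) = f k := by
  by_contra! hne
  have h1 : ∀ m, m ≤ f k₀ + 1 → f (k₀ + m) + m ≤ f k₀ := by
    intro m hm
    induction m with
    | zero => exact le_rfl
    | succ m ih =>
      have h2 := ih (by omega)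
      have h3 := h (k₀ + m) (by omega)
      have h4 := hne (k₀ + m) (by omega) (by omega)
      rw [Nat.add_assoc] at h3 h4
      omega
  have := h1 _ le_rfl
  omega

open Classical in
-- A transition is determined by the edge that each player takes.
theorem card_step_le {V : Type*} [Fintype V] (A : Arena V) (n : ℕ) :
    (Finset.univ.filter fun t : Fin n × Config V n × Config V n => Step A t.2.1 t.2.2).card ≤
      n * A.numEdges ^ n := by
  set E := Finset.univ.filter fun p : V × V => (A.edge p.1 p.2).isSome
  have h := Finset.card_le_card_of_injOn
    (s := Finset.univ.filter fun t : Fin n × Config V n × Config V n => Step A t.2.1 t.2.2)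
    (t := (Finset.univ : Finset (Fin n)) ×ˢ Fintype.piFinset fun _ : Fin n => E)
    (fun t => (t.1, fun i => (t.2.1 i, t.2.2 i)))
    (fun t ht => by
      simp only [Finset.coe_filter, Finset.mem_univ, true_and, Set.mem_ofPred_eq] at ht
      simp only [Finset.coe_product, Finset.coe_univ, Set.mem_prod, Set.mem_univ, true_and,
        Finset.mem_coe, Fintype.mem_piFinset, E, Finset.mem_filter, Finset.mem_univ]
      exact ht)
    (fun s _ t _ hst => by
      simp only [Prod.mk.injEq, funext_iff] at hst
      refine Prod.ext hst.1 (Prod.ext (funext fun i => ?_) (funext fun i => ?_))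
      · exact (hst.2 i).1
      · exact (hst.2 i).2)
  simpa [E, Arena.numEdges] using h

theorem limitLabelling_eq {V : Type*} {n : ℕ} {u : ℕ → Labelling V n} {i : Fin n}
    {c c' : Config V n} {N : ℕ} (h : ∀ k, N ≤ k → u k i c c' = u N i c c') : limitLabelling u i c c' = u N i c c' := by
  have hev : ∀ᶠ k in Filter.atTop, u k i c c' = u N i c c' := Filter.eventually_atTop.2 ⟨N, h⟩
  have hlim : ∀ᶠ k in Filter.atTop, u k i c c' = limitLabelling u i c c' :=
    Classical.epsilon_spec (p := fun v => ∀ᶠ k in Filter.atTop, u k i c c' = v) ⟨_, hev⟩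
  obtain ⟨k, h1, h2⟩ := (hev.and hlim).exists
  exact h2.symm.trans h1

variable {V : Type*} [Fintype V] [DecidableEq V] {n : ℕ} {A : Arena V} {j : ℕ}
  {next : Labelling V n}

open Classical in
-- The first `|V|` steps make all labels finite or `⊥`; the remaining `|V| · n · κ · |E|^n` bound
-- the sum of their ranks at that moment.
theorem building_stabilizes
    (hnext : ∀ i c c', j + 1 ≤ numAtTarget A c → Step A c c' →
      next i c c' ≤ ((A.dist (c i) * A.maxCost n : ℕ) : ℕ∞))
    (hnext0 : A.maxCost n = 0 →
      ∀ i c c', j + 1 ≤ numAtTarget A c → Step A c c' → 0 ≤ next i c c')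
    {k : ℕ} (hk : Fintype.card V * (1 + n * A.maxCost n * A.numEdges ^ n) ≤ k) :
    EqOnRegion A j (building A j next k)
      (building A j next (Fintype.card V * (1 + n * A.maxCost n * A.numEdges ^ n))) := by
  set N := Fintype.card V * (1 + n * A.maxCost n * A.numEdges ^ n) with hN
  have hVN : Fintype.card V ≤ N := Nat.le_mul_of_pos_right _ (by omega)
  have hdist : ∀ {l v}, Fintype.card V ≤ l → A.dist v ≤ l :=
    fun {l v} hl => (A.dist_lt_card v).le.trans hl
  rcases Nat.eq_zero_or_pos (A.maxCost n) with h0 | hpos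
  -- For `κ = 0` the rank bound below fails, as ranks can be `1`; but here all labels equal `0`
  -- after `|V|` iterations.
  · intro i c c' hc hs
    have key : ∀ l, Fintype.card V ≤ l → building A j next l i c c' = 0 := fun l hl =>
      le_antisymm ((building_le_dist_mul hnext hc hs (hdist hl)).trans (by rw [h0]; rfl))
        (building_nonneg_of_maxCost h0 (hnext0 h0) hc hs)
    rw [key k (hVN.trans hk), key N hVN]
  set S := Finset.univ.filter fun t : Fin n × Config V n × Config V n =>
    j ≤ numAtTarget A t.2.1 ∧ Step A t.2.1 t.2.2 with hS
  set Φ : ℕ → ℕ := fun l => ∑ t ∈ S, labelRank (building A j next l t.1 t.2.1 t.2.2) with hΦ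
  have hbound : ∀ l, Fintype.card V ≤ l → ∀ t ∈ S,
      building A j next l t.1 t.2.1 t.2.2 ≤
        ((A.dist (t.2.1 t.1) * A.maxCost n : ℕ) : ℕ∞) := fun l hl t ht => by
    simp only [hS, Finset.mem_filter, Finset.mem_univ, true_and] at ht
    exact building_le_dist_mul hnext ht.1 ht.2 (hdist hl)
  have hterm : ∀ l, Fintype.card V ≤ l → ∀ t ∈ S,
      labelRank (building A j next (l + 1) t.1 t.2.1 t.2.2) ≤
        labelRank (building A j next l t.1 t.2.1 t.2.2) := fun l hl t ht => by
    rcases (building_antitone A j next (Nat.le_succ l) t.1 t.2.1 t.2.2).eq_or_lt with h | h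
    · exact (congrArg labelRank h).le
    · exact (labelRank_lt (hbound l hl t ht) h).le
  obtain ⟨l, hl0, hl1, hl⟩ := exists_eq_succ_of_antitone (f := Φ) (k₀ := Fintype.card V)
    fun l hl => Finset.sum_le_sum (hterm l hl)
  have hcard : S.card ≤ n * A.numEdges ^ n :=
    (Finset.card_le_card (Finset.monotone_filter_right _ fun t _ ht => ht.2)).trans
      (card_step_le A n)
  have hΦV : Φ (Fintype.card V) ≤ n * A.numEdges ^ n * (Fintype.card V * A.maxCost n) := by
    refine (Finset.sum_le_card_nsmul S _ (Fintype.card V * A.maxCost n) fun t ht => ?_).trans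
      (Nat.mul_le_mul_right _ hcard)
    refine (labelRank_le (hbound _ le_rfl t ht)).trans ?_
    -- The distance is at most `|V| - 1`, and the spare `κ ≥ 1` absorbs the `+ 1` in the rank.
    have := Nat.mul_le_mul_right (A.maxCost n) (A.dist_lt_card (t.2.1 t.1))
    rw [Nat.succ_mul] at this
    omega
  have hlN : l ≤ N := by
    refine hl1.trans ((Nat.add_le_add_left hΦV _).trans (le_of_eq ?_))
    rw [hN]
    ring
  have hst : EqOnRegion A j (building A j next (l + 1)) (building A j next l) := by
    intro i c c' hc hs
    have ht : ((i, c, c') : Fin n × Config V n × Config V n) ∈ S := by simp [hS, hc, hs]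
    -- No rank increases, so equal sums force equality of every rank, and then of every label.
    have heq := (Finset.sum_eq_sum_iff_of_le (hterm l hl0)).1 hl (i, c, c') ht
    refine (building_antitone A j next (Nat.le_succ l) i c c').eq_or_lt.resolve_right fun h => ?_
    exact (labelRank_lt (hbound l hl0 _ ht) h).ne heq
  intro i c c' hc hs
  rw [hst.building_of_succ (hlN.trans hk) i c c' hc hs, hst.building_of_succ hlN i c c' hc hs]

theorem building_eq_limitLabelling
    (hnext : ∀ i c c', j + 1 ≤ numAtTarget A c → Step A c c' →
      next i c c' ≤ ((A.dist (c i) * A.maxCost n : ℕ) : ℕ∞))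
    (hnext0 : A.maxCost n = 0 →
      ∀ i c c', j + 1 ≤ numAtTarget A c → Step A c c' → 0 ≤ next i c c')
    {k : ℕ} (hk : Fintype.card V * (1 + n * A.maxCost n * A.numEdges ^ n) ≤ k) :
    EqOnRegion A j (building A j next k) (limitLabelling (building A j next)) := by
  intro i c c' hc hs
  rw [limitLabelling_eq fun l hl => building_stabilizes hnext hnext0 hl i c c' hc hs]
  exact building_stabilizes hnext hnext0 hk i c c' hc hs

/-- Both claims go together in the downward induction, since stabilization at level `j` needs both
for level `j + 1`. -/
theorem lamStar_bounds (A : Arena V) (hj : j ≤ n) :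
    (∀ i c c', j ≤ numAtTarget A c → Step A c c' →
      lamStar A n j i c c' ≤ ((A.dist (c i) * A.maxCost n : ℕ) : ℕ∞)) ∧
    (A.maxCost n = 0 →
      ∀ i c c', j ≤ numAtTarget A c → Step A c c' → 0 ≤ lamStar A n j i c c') := by
  induction hj using Nat.decreasingInduction with
  | self =>
    rw [lamStar, if_neg (lt_irrefl n)]
    exact ⟨fun _ _ _ _ _ => WithBot.coe_le_coe.2 (zero_le), fun _ _ _ _ _ _ => le_rfl⟩
  | of_succ j hj ih =>
    rw [lamStar, if_pos hj]
    have key := building_eq_limitLabelling ih.1 ih.2 le_rfl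
    have hV : Fintype.card V ≤ Fintype.card V * (1 + n * A.maxCost n * A.numEdges ^ n) :=
      Nat.le_mul_of_pos_right _ (by omega)
    refine ⟨fun i c c' hc hs => ?_, fun h0 i c c' hc hs => ?_⟩
    · rw [← key i c c' hc hs]
      exact building_le_dist_mul ih.1 hc hs ((A.dist_lt_card _).le.trans hV)
    · rw [← key i c c' hc hs]
      exact building_nonneg_of_maxCost h0 (ih.2 h0) hc hs

theorem building_eq_lamStar (A : Arena V) (hj : j < n) {k : ℕ}
    (hk : Fintype.card V * (1 + n * A.maxCost n * A.numEdges ^ n) ≤ k) :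
    EqOnRegion A j (building A j (lamStar A n (j + 1)) k) (lamStar A n j) := by
  have ih := lamStar_bounds A (Nat.succ_le_of_lt hj)
  rw [lamStar.eq_def A n j, if_pos hj]
  exact building_eq_limitLabelling ih.1 ih.2 hk

theorem lamStar_eq_succ (A : Arena V) (hj : j < n) :
    EqOnRegion A (j + 1) (lamStar A n j) (lamStar A n (j + 1)) := fun i c c' hc hs => by
  rw [← building_eq_lamStar A hj le_rfl i c c' (Nat.le_of_succ_le hc) hs, building_of_le hc]

theorem lamStar_zero_eq (A : Arena V) (hj : j ≤ n) :
    EqOnRegion A j (lamStar A n 0) (lamStar A n j) := by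
  induction j with
  | zero => exact fun _ _ _ _ _ => rfl
  | succ j ih =>
    exact fun i c c' hc hs =>
      (ih (Nat.le_of_succ_le hj) i c c' (Nat.le_of_succ_le hc) hs).trans
        (lamStar_eq_succ A hj i c c' hc hs)

/-- The labelling `λ^{0*}` is a fixed point of `improve`. -/
theorem lamStar_zero_eq_improve (A : Arena V) {i : Fin n} {c c' : Config V n} (hs : Step A c c')
    (hi : c i ≠ A.tgt) : lamStar A n 0 i c c' = improve A (lamStar A n 0) i c c' := by
  -- At exactly this level the label of the transition is computed by `improve` rather than
  -- inherited; the iterates `K` and `K + 1` both equal the limit on the region.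
  set j := numAtTarget A c with hj
  have hjn : j < n := by
    by_contra! h
    exact hi (congrFun (eq_tgtConfig_of_numAtTarget h) i)
  set K := Fintype.card V * (1 + n * A.maxCost n * A.numEdges ^ n)
  have h1 : EqOnRegion A j (lamStar A n 0) (building A j (lamStar A n (j + 1)) K) :=
    fun i c c' hc hs => (lamStar_zero_eq A hjn.le i c c' hc hs).trans
      (building_eq_lamStar A hjn le_rfl i c c' hc hs).symm
  rw [improve_congr h1 i c' hj.le, ← building_succ_of_ne_tgt (j := j)
    (next := lamStar A n (j + 1)) (by omega) hi, lamStar_zero_eq A hjn.le i c c' hj.le hs,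
    building_eq_lamStar A hjn (Nat.le_succ K) i c c' hj.le hs]

end Stabilization

/-! ### Strategy profiles, residuals, and consistency of SPE outcomes. -/

section Profiles

variable {V : Type*} {n : ℕ} {A : Arena V} {c : Config V n}

theorem FinPath.append_assoc {d e f : Config V n} (h : FinPath A c d) (h' : FinPath A d e)
    (h'' : FinPath A e f) : (h.append h').append h'' = h.append (h'.append h'') := by
  induction h'' with
  | nil => rfl
  | snoc h'' s ih => simp only [FinPath.append, ih]

theorem FinPath.nil_append {d : Config V n} (h : FinPath A c d) :
    (FinPath.nil : FinPath A c c).append h = h := by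
  induction h with
  | nil => rfl
  | snoc h s ih => simp only [FinPath.append, ih]

theorem residual_nil (σ : Profile A c) : residual σ .nil = σ := by
  funext i e h
  simp only [residual, FinPath.nil_append]

theorem residual_residual {d e : Config V n} (σ : Profile A c) (h : FinPath A c d)
    (h' : FinPath A d e) : residual (residual σ h) h' = residual σ (h.append h') := by
  funext i f h''
  simp only [residual, FinPath.append_assoc]

theorem isPathFrom_outcome (σ : Profile A c) : IsPathFrom A c (outcome σ) :=
  ⟨rfl, fun k i => (σ i (run σ k).1 (run σ k).2).2⟩

/-- The history obtained from a history by playing one more round of a profile. -/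
def playRound (σ : Profile A c) (x : Σ d : Config V n, FinPath A c d) :
    Σ d : Config V n, FinPath A c d :=
  ⟨fun i => (σ i x.1 x.2).1, .snoc x.2 fun i => (σ i x.1 x.2).2⟩

theorem run_add (σ : Profile A c) {m : ℕ} {d : Config V n} {h : FinPath A c d}
    (hm : run σ m = ⟨d, h⟩) (k : ℕ) :
    run σ (m + k) = ⟨(run (residual σ h) k).1, h.append (run (residual σ h) k).2⟩ := by
  induction k with
  | zero => exact hm
  | succ k ih =>
    -- As a function of the whole pair, the round lets configuration and history be rewritten
    -- together.
    change playRound σ (run σ (m + k)) = _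
    rw [ih]
    rfl

theorem suffix_outcome (σ : Profile A c) {m : ℕ} {d : Config V n} {h : FinPath A c d}
    (hm : run σ m = ⟨d, h⟩) : suffix (outcome σ) m = outcome (residual σ h) :=
  funext fun k => congrArg Sigma.fst (run_add σ hm k)

theorem mk_snoc_nil_eq {d d' : Config V n} (h : d = d') (s : Step A c d) (s' : Step A c d') :
    (⟨d, .snoc .nil s⟩ : Σ d : Config V n, FinPath A c d) = ⟨d', .snoc .nil s'⟩ := by
  subst h
  rfl

theorem outcome_update_mem_dev (σ : Profile A c) (i : Fin n) (τ : Strategy A c i) (k : ℕ) :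
    outcome (Function.update σ i τ) (k + 1) ∈ dev A i (outcome (Function.update σ i τ) k)
      fun l => (σ l _ (run (Function.update σ i τ) k).2).1 := by
  refine ⟨(isPathFrom_outcome _).2 k, fun l hl => ?_⟩
  change (Function.update σ i τ l _ (run (Function.update σ i τ) k).2).1 = _
  rw [Function.update_of_ne hl]

variable [DecidableEq V]

theorem IsSPE.residual {σ : Profile A c} (hσ : IsSPE σ) {d : Config V n} (h : FinPath A c d) :
    IsSPE (residual σ h) := fun e h' => by
  rw [residual_residual]
  exact hσ e _

theorem IsSPE.isNash {σ : Profile A c} (hσ : IsSPE σ) : IsNash σ := by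
  have := hσ c .nil
  rwa [residual_nil] at this

theorem IsNash.pathCost_le {σ : Profile A c} (hσ : IsNash σ) (i : Fin n) (τ : Strategy A c i) :
    pathCost A i (outcome σ) ≤ pathCost A i (outcome (Function.update σ i τ)) :=
  (hσ i).trans_le (iInf_le _ τ)

theorem isNash_of_pathCost_le {σ : Profile A c}
    (h : ∀ i (τ : Strategy A c i),
      pathCost A i (outcome σ) ≤ pathCost A i (outcome (Function.update σ i τ))) : IsNash σ :=
  fun i => le_antisymm (le_iInf (h i))
    ((iInf_le _ (σ i)).trans_eq (by rw [Function.update_eq_self]))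

/-- Under a Nash equilibrium, no one-shot deviation of a player from the first move is
profitable. -/
theorem IsNash.pathCost_le_oneShot {σ : Profile A c} (hσ : IsNash σ) (i : Fin n)
    {c'' : Config V n} (hc'' : c'' ∈ dev A i c (outcome σ 1)) :
    pathCost A i (outcome σ) ≤ stepCost A i c c'' +
      pathCost A i (outcome (residual σ (.snoc .nil hc''.1))) := by
  obtain ⟨s, hdev⟩ := hc''
  -- Deviate on the empty history only; after the first move, the residual profile is that of `σ`.
  let τ : Strategy A c i := fun d h => match d, h with
    | _, .nil => ⟨c'' i, s i⟩
    | d, .snoc h s => σ i d (.snoc h s)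
  have hmove : (fun l => (Function.update σ i τ l c .nil).1) = c'' := by
    funext l
    by_cases hl : l = i
    · subst hl
      rw [Function.update_self]
    · rw [Function.update_of_ne hl]
      exact (hdev l hl).symm
  have hrun : run (Function.update σ i τ) 1 = ⟨c'', .snoc .nil s⟩ := mk_snoc_nil_eq hmove _ _
  have hres : residual (Function.update σ i τ) (.snoc .nil s) = residual σ (.snoc .nil s) := by
    funext l e h
    by_cases hl : l = i
    · subst hl
      simp only [DynNCG.residual, Function.update_self]
      cases h <;> rfl
    · simp only [DynNCG.residual, Function.update_of_ne hl]
  refine (hσ.pathCost_le i τ).trans_eq ?_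
  rw [(isPathFrom_outcome _).pathCost_eq_add, suffix_outcome _ hrun, hres]
  exact congrArg (fun d : Config V n => (stepCost A i c d : ℕ∞) + _) hmove

/-- Under a Nash equilibrium, every player reaches the target. -/
theorem IsNash.exists_eq_tgt {σ : Profile A c} (hσ : IsNash σ) (i : Fin n) :
    ∃ k, outcome σ k i = A.tgt := by
  -- Walking along a shortest path has finite cost whatever the others do, so a best response has
  -- finite cost.
  let τ : Strategy A c i := fun d _ => ⟨A.toward (d i), A.isEdge_toward _⟩
  have hmove : ∀ k, outcome (Function.update σ i τ) k i = A.toward^[k] (c i) := by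
    intro k
    induction k with
    | zero => rfl
    | succ k ih =>
      rw [Function.iterate_succ_apply', ← ih]
      change (Function.update σ i τ i _ (run (Function.update σ i τ) k).2).1 = _
      rw [Function.update_self]
      rfl
  refine exists_eq_tgt_of_pathCost_ne_top (ne_top_of_le_ne_top ?_ (hσ.pathCost_le i τ))
  refine (isPathFrom_outcome _).pathCost_ne_top (K := A.dist (c i))
    (A.eq_tgt_of_dist_eq_zero ?_)
  rw [hmove, A.dist_toward_iterate, Nat.sub_self]

theorem IsNash.exists_eq_tgtConfig {σ : Profile A c} (hσ : IsNash σ) :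
    ∃ k, outcome σ k = tgtConfig A n := by
  choose K hK using hσ.exists_eq_tgt
  exact ⟨Finset.univ.sup K, funext fun i =>
    (isPathFrom_outcome σ).eq_tgt_of_le (Finset.le_sup (Finset.mem_univ i)) (hK i)⟩

/-- Each suffix of an SPE outcome is the outcome of a residual SPE, so bounding first transitions
suffices. -/
theorem outcome_mem_consistentPaths {j : ℕ} {lam : Labelling V n}
    (hlam : ∀ (c : Config V n) (σ : Profile A c), IsSPE σ → j ≤ numAtTarget A c →
      ∀ i, ((pathCost A i (outcome σ) : ℕ∞) : WithBot ℕ∞) ≤ lam i c (outcome σ 1))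
    {σ : Profile A c} (hσ : IsSPE σ) (hc : j ≤ numAtTarget A c) :
    outcome σ ∈ consistentPaths A lam c := by
  have hpath := isPathFrom_outcome σ
  refine ⟨hpath, hσ.isNash.exists_eq_tgtConfig, fun i k => ?_⟩
  have hsuf := suffix_outcome σ (m := k) rfl
  have hk := hlam _ _ (hσ.residual (run σ k).2) (hc.trans (hpath.numAtTarget_le k)) i
  rw [← hsuf] at hk
  exact hk

/-- By induction on `k`, the residual outcome after any first transition is a consistent path. This
rules out the label `⊥`, and the one-shot deviation inequality bounds the cost by each supremum. -/
theorem IsSPE.pathCost_le_building {j : ℕ} {next : Labelling V n}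
    (hnext : ∀ (c : Config V n) (σ : Profile A c), IsSPE σ → j + 1 ≤ numAtTarget A c →
      ∀ i, ((pathCost A i (outcome σ) : ℕ∞) : WithBot ℕ∞) ≤ next i c (outcome σ 1))
    (k : ℕ) {σ : Profile A c} (hσ : IsSPE σ) (hc : j ≤ numAtTarget A c) (i : Fin n) :
    ((pathCost A i (outcome σ) : ℕ∞) : WithBot ℕ∞) ≤
      building A j next k i c (outcome σ 1) := by
  induction k generalizing c i with
  | zero =>
    by_cases h : j + 1 ≤ numAtTarget A c
    · rw [building_of_le h]
      exact hnext c σ hσ h i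
    by_cases hi : c i = A.tgt
    · rw [building_of_eq_tgt h hi, (isPathFrom_outcome σ).pathCost_eq_zero hi]
      rfl
    · rw [building_zero_of_ne_tgt h hi]
      exact le_top
  | succ k ih =>
    by_cases h : j + 1 ≤ numAtTarget A c
    · rw [building_of_le h]
      exact hnext c σ hσ h i
    by_cases hi : c i = A.tgt
    · rw [building_of_eq_tgt h hi, (isPathFrom_outcome σ).pathCost_eq_zero hi]
      rfl
    have hmem : ∀ d (s : Step A c d),
        outcome (DynNCG.residual σ (.snoc .nil s)) ∈
          consistentPaths A (building A j next k) d := fun d s =>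
      outcome_mem_consistentPaths (fun c σ hσ hc i => ih hσ hc i) (hσ.residual _)
        (hc.trans s.numAtTarget_le)
    rw [building_succ_of_ne_tgt h hi, improve, if_pos fun d s => ⟨_, hmem d s⟩]
    refine WithBot.coe_le_coe.2 (le_iInf₂ fun c'' hc'' => ?_)
    exact (hσ.isNash.pathCost_le_oneShot i hc'').trans (le_iSup₂_of_le _ (hmem c'' hc''.1) le_rfl)

theorem IsSPE.pathCost_le_lamStar [Fintype V] {j : ℕ} (hj : j ≤ n) {σ : Profile A c}
    (hσ : IsSPE σ) (hc : j ≤ numAtTarget A c) (i : Fin n) :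
    ((pathCost A i (outcome σ) : ℕ∞) : WithBot ℕ∞) ≤ lamStar A n j i c (outcome σ 1) := by
  induction hj using Nat.decreasingInduction generalizing c i with
  | self =>
    rw [lamStar, if_neg (lt_irrefl n), (isPathFrom_outcome σ).pathCost_eq_zero
      (congrFun (eq_tgtConfig_of_numAtTarget hc) i)]
    rfl
  | of_succ j hj ih =>
    rw [← building_eq_lamStar A hj le_rfl i c _ hc ((isPathFrom_outcome σ).2 0)]
    exact hσ.pathCost_le_building (fun c σ hσ hc i => ih hσ hc i) _ hc i

/-! ### From consistent paths to equilibria. -/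

section Plans

variable {Λ : Config V n → Set (ℕ → Config V n)}

/-- The path that is planned after each history, given the path that is planned initially and a
revision of the plan after each transition. -/
def plan (π₀ : Λ c) (revise : ∀ d d', Λ d → Step A d d' → Λ d') :
    {d : Config V n} → FinPath A c d → Λ d
  | _, .nil => π₀
  | _, .snoc h s => revise _ _ (plan π₀ revise h) s

/-- A system of paths, in which each path can be replaced after each transition by one that makes
that transition unprofitable, consists of outcomes of subgame-perfect equilibria. -/
theorem exists_isSPE_of_revise (hΛ : ∀ d, ∀ π ∈ Λ d, IsPathFrom A d π)
    (hrev : ∀ d d', ∀ π ∈ Λ d, Step A d d' → ∃ π' ∈ Λ d', (d' = π 1 → π' = suffix π 1) ∧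
      ∀ i, d' ∈ dev A i d (π 1) → pathCost A i π ≤ stepCost A i d d' + pathCost A i π')
    {ρ : ℕ → Config V n} (hρ : ρ ∈ Λ c) : ∃ σ : Profile A c, IsSPE σ ∧ outcome σ = ρ := by
  choose rev hrev1 hrev2 hrev3 using hrev
  let revise : ∀ d d', Λ d → Step A d d' → Λ d' :=
    fun d d' π s => ⟨rev d d' π.1 π.2 s, hrev1 d d' π.1 π.2 s⟩
  let P : {d : Config V n} → FinPath A c d → Λ d := fun h => plan ⟨ρ, hρ⟩ revise h
  have hP : ∀ {d} (h : FinPath A c d), IsPathFrom A d (P h).1 := fun h => hΛ _ _ (P h).2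
  have hPstep : ∀ {d} (h : FinPath A c d), Step A d ((P h).1 1) := fun {d} h => by
    have := (hP h).2 0
    rwa [(hP h).1] at this
  let σ : Profile A c := fun i d h => ⟨(P h).1 1 i, hPstep h i⟩
  have hplan : ∀ {d} (h : FinPath A c d) (k : ℕ),
      (P (h.append (run (residual σ h) k).2)).1 = suffix (P h).1 k := by
    intro d h k
    induction k with
    | zero => exact funext fun l => congrArg (P h).1 (Nat.zero_add l).symm
    | succ k ih =>
      rw [← suffix_suffix, ← ih]
      exact hrev2 _ _ _ (P (h.append (run (residual σ h) k).2)).2 _ rfl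
  have hout : ∀ {d} (h : FinPath A c d), outcome (residual σ h) = (P h).1 := by
    intro d h
    funext k
    have h1 := (hP (h.append (run (residual σ h) k).2)).1
    rw [hplan] at h1
    exact h1.symm
  refine ⟨σ, fun d h => isNash_of_pathCost_le fun i τ => ?_, ?_⟩
  · rw [hout]
    set σ' := Function.update (residual σ h) i τ with hσ'
    have hpath := isPathFrom_outcome σ'
    -- The cost already paid by the deviator plus the cost of the current plan never falls below the
    -- cost of the original plan.
    have key : ∀ K, pathCost A i (P h).1 ≤
        ∑ k ∈ Finset.range K, (stepCost A i (outcome σ' k) (outcome σ' (k + 1)) : ℕ∞) +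
          pathCost A i (P (h.append (run σ' K).2)).1 := by
      intro K
      induction K with
      | zero => exact (zero_add _).ge
      | succ K ih =>
        rw [Finset.sum_range_succ, add_assoc]
        refine ih.trans (add_le_add_right ?_ _)
        exact hrev3 _ _ _ (P (h.append (run σ' K).2)).2 (hpath.2 K) i
          (outcome_update_mem_dev (residual σ h) i τ K)
    by_cases hv : ∃ K, outcome σ' K i = A.tgt
    · obtain ⟨K, hK⟩ := hv
      refine (key K).trans_eq ?_
      rw [hpath.pathCost_eq_sum hK, (hP (h.append (run σ' K).2)).pathCost_eq_zero hK, add_zero]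
    · push Not at hv
      rw [pathCost.eq_def A i (outcome σ'), if_pos hv]
      exact le_top
  · have := hout .nil
    rwa [residual_nil] at this

end Plans

/-- If the plan is followed, keep its suffix. Otherwise the fixed-point equation bounds the planned
cost by the worst consistent continuation after the deviation, and a continuation attaining at least
this cost serves as the punishment. -/
theorem exists_revision [Fintype V] {d : Config V n} {π : ℕ → Config V n}
    (hπ : π ∈ consistentPaths A (lamStar A n 0) c) (hs : Step A c d) :
    ∃ π' ∈ consistentPaths A (lamStar A n 0) d, (d = π 1 → π' = suffix π 1) ∧
      ∀ i, d ∈ dev A i c (π 1) → pathCost A i π ≤ stepCost A i c d + pathCost A i π' := by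
  by_cases hd : d = π 1
  · refine ⟨suffix π 1, hd ▸ suffix_mem_consistentPaths hπ 1, fun _ => rfl, fun i _ => ?_⟩
    rw [hπ.1.pathCost_eq_add, hd]
  have hπs : Step A c (π 1) := by
    have := hπ.1.2 0
    rwa [hπ.1.1] at this
  have hlab : ∀ i, c i ≠ A.tgt →
      (∀ d, Step A c d → (consistentPaths A (lamStar A n 0) d).Nonempty) ∧
      pathCost A i π ≤ ⨅ c'' ∈ dev A i c (π 1), ⨆ ρ ∈ consistentPaths A (lamStar A n 0) c'',
        ((stepCost A i c c'' : ℕ∞) + pathCost A i ρ) := fun i hi => by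
    have h := pathCost_le_of_mem hπ i
    rw [lamStar_zero_eq_improve A hπs hi, improve] at h
    split_ifs at h with hne
    · exact ⟨hne, WithBot.coe_le_coe.1 h⟩
    · exact absurd (le_bot_iff.1 h) WithBot.coe_ne_bot
  -- A player leaving the plan is not at the target, so the label is not `⊥` and `d` has a
  -- consistent path. Only this player can be a unilateral deviator.
  obtain ⟨l, hl⟩ : ∃ l, d l ≠ π 1 l := Function.ne_iff.1 hd
  have hlt : c l ≠ A.tgt := fun h => hl <| by
    have h1 := hs l
    have h2 := hπs l
    rw [h] at h1 h2
    rw [A.eq_tgt_of_isEdge h1, A.eq_tgt_of_isEdge h2]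
  have hne := (hlab l hlt).1 d hs
  have hdev : ∀ i, d ∈ dev A i c (π 1) → i = l := fun i hi => by
    by_contra h
    exact hl (hi.2 l (Ne.symm h))
  by_cases hdl : d ∈ dev A l c (π 1)
  · have hfin : pathCost A l π ≠ ⊤ := by
      obtain ⟨k, hk⟩ := hπ.2.1
      exact hπ.1.pathCost_ne_top (K := k) (by rw [hk]; rfl)
    have hle := (hlab l hlt).2.trans (iInf₂_le d hdl)
    obtain ⟨π', hπ', hcost⟩ : ∃ π' ∈ consistentPaths A (lamStar A n 0) d,
        pathCost A l π ≤ stepCost A l c d + pathCost A l π' := by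
      -- The planned cost is finite: if it is `N + 1` and all punishments give less, their supremum
      -- is at most `N`. For cost `0` any consistent path works.
      by_contra! hlt'
      lift pathCost A l π to ℕ using hfin with N
      rcases N with _ | N
      · obtain ⟨π', hπ'⟩ := hne
        exact absurd (hlt' π' hπ') (by simp)
      · have h1 := hle.trans (iSup₂_le fun π' hπ' =>
          ENat.lt_natCast_add_one_iff.1 (by exact_mod_cast hlt' π' hπ'))
        exact absurd (Nat.cast_le.1 h1) (Nat.not_succ_le_self N)
    exact ⟨π', hπ', fun h => absurd h hd, fun i hi => hdev i hi ▸ hcost⟩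
  · obtain ⟨π', hπ'⟩ := hne
    exact ⟨π', hπ', fun h => absurd h hd, fun i hi => absurd (hdev i hi ▸ hi) hdl⟩

end Profiles

end DynNCG

/-! ### The main theorem. -/

theorem mainTheorem9 {V : Type*} [Fintype V] [DecidableEq V] (A : DynNCG.Arena V) (n : ℕ) :
    (∀ ρ : ℕ → DynNCG.Config V n,
      (∃ σ : DynNCG.Profile A (DynNCG.srcConfig A n), DynNCG.IsSPE σ ∧ DynNCG.outcome σ = ρ) ↔
        ρ ∈ DynNCG.consistentPaths A (DynNCG.lamStar A n 0) (DynNCG.srcConfig A n)) ∧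
    (∀ j, j ≤ n → ∀ (i : Fin n) (c c' : DynNCG.Config V n),
      j ≤ DynNCG.numAtTarget A c → DynNCG.Step A c c' →
        DynNCG.lamStar A n j i c c' ≤
          (((Fintype.card V * A.maxCost n : ℕ) : ℕ∞) : WithBot ℕ∞)) ∧
    (∀ j, j < n → ∀ k, Fintype.card V * (1 + n * A.maxCost n * A.numEdges ^ n) ≤ k →
      ∀ (i : Fin n) (c c' : DynNCG.Config V n),
        j ≤ DynNCG.numAtTarget A c → DynNCG.Step A c c' →
          DynNCG.building A j (DynNCG.lamStar A n (j + 1)) k i c c' =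
            DynNCG.lamStar A n j i c c') := by
  refine ⟨fun ρ => ⟨?_, fun hρ => ?_⟩, fun j hj i c c' hc hs => ?_,
    fun j hj k hk i c c' hc hs => DynNCG.building_eq_lamStar A hj hk i c c' hc hs⟩
  · rintro ⟨σ, hσ, rfl⟩
    exact DynNCG.outcome_mem_consistentPaths (j := 0)
      (fun c σ hσ hc i => hσ.pathCost_le_lamStar (Nat.zero_le n) hc i) hσ (Nat.zero_le _)
  · exact DynNCG.exists_isSPE_of_revise
      (Λ := fun c => DynNCG.consistentPaths A (DynNCG.lamStar A n 0) c)
      (fun d π hπ => hπ.1) (fun d d' π hπ hs => DynNCG.exists_revision hπ hs) hρ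
  · refine ((DynNCG.lamStar_bounds A hj).1 i c c' hc hs).trans (WithBot.coe_le_coe.2 ?_)
    exact Nat.cast_le.2 (Nat.mul_le_mul_right _ (A.dist_lt_card (c i)).le)
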